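/- Let $\Psi=\{f_i\}_{i\in M}$, $M=\{0,\dots,m-1\}$, be a system of contracting similitudes of $\mathbb{R}^n$ ($n\ge 1$) with ratios $r_i\in(0,1)$, and let $E$ be the self-similar set of $\Psi$, i.e. the unique non-empty compact set with $E=\bigcup_{i\in M} f_i(E)$. A non-empty open set $\mathcal{O}$ is *feasible* for $\Psi$ if $f_i(\mathcal{O})\subset\mathcal{O}$ for all $i$ and $f_i(\mathcal{O})\cap f_j(\mathcal{O})=\varnothing$ for $i\ne j$; assume that a feasible open set $\mathcal{O}$ is given. Let $\mathbf{p}=(p_i)_{i\in M}$ with $p_i>0$ and $\sum_i p_i=1$, and let $\mu_{\mathbf p}$ be the self-similar measure, i.e. the unique compactly supported Borel probability measure with $\mu_{\mathbf p}=\sum_i p_i\,(f_i)_\sharp\mu_{\mathbf p}$. For a finite word $w=w_1\cdots w_k\in M^*=\bigcup_{k\ge0}M^k$ put $f_w=f_{w_1}\circ\cdots\circ f_{w_k}$, $r_w=r_{w_1}\cdots r_{w_k}$, $p_w=p_{w_1}\cdots p_{w_k}$. $B(x,d)$, $d>0$, denotes a closed Euclidean ball, $\alpha\lfloor_A$ a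 restriction, $g_\sharp\alpha$ an image measure, and $\alpha_j\xrightarrow{st}\alpha$ means $\alpha_j(A)\to\alpha(A)$ for every Borel set $A$. Let $\pi:M^{\mathbb N}\to E$, $\{\pi(i)\}=\bigcap_{k} f_{i_1\cdots i_k}(E)$, let $\sigma$ be the shift on $M^{\mathbb N}$, let $\mathcal{T}=\pi\circ\sigma\circ\pi^{-1}$ be the (set-valued) geometric shift on $E$, and let $\widehat E$ be the set of $y\in E$ such that $\bigcup_{k\ge1}\mathcal{T}^k(y)$ is dense in $E$. For Radon measures on $\mathbb{R}^n$ write $\alpha\cong\beta$ if $\beta=\lambda\, g_\sharp\alpha$ for some isometry $g$ of $\mathbb{R}^n$ and some $\lambda>0$, and let $\widetilde\alpha$ be the class of $\alpha$. For $R>0$, a Radon measure $\nu$ and $x\in\operatorname{spt}\nu$, let $\widetilde{Tan}^{st}_R(\nu,x)$ be the set of classes $\widetilde\alpha$ of non-null Radon measures $\alpha$ for which there are $0<d\le R$, constants $c_k>0$ and similitudes $g_k$ of ratios $t_k\to\infty$ such that $$c_k\,\nu(B(x,d/t_k))^{-1}\,(g_k)_\sharp\bigl(\nu\lfloor_{B(x,d/t_k)}\bigr)\xrightarrow[k\to\infty]{st}\alpha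 .$$ ($\widetilde{Tan}^{st}=\widetilde{Tan}^{st}_1$ is the usual normalisation.) A ball $B(z,d)$ is *typical* if $z\in E$ and $B(z,d)$ is contained in some feasible open set. Then the following hold. (i) For every $\mu_{\mathbf p}$-measurable $B\subset\mathcal{O}$ and every $w\in M^*$, $\ \mu_{\mathbf p}\lfloor_{f_w(B)}=p_w\,(f_w)_\sharp(\mu_{\mathbf p}\lfloor_B)$. (ii) For every $\mu_{\mathbf p}$-measurable $B\subset\mathcal{O}$ and every $w\in M^*$, $\ \mu_{\mathbf p}\lfloor_{B}=p_w^{-1}\,(f_w^{-1})_\sharp(\mu_{\mathbf p}\lfloor_{f_w(B)})$. (iii) $\widehat E\subset E$ has full measure, $\mu_{\mathbf p}(\widehat E)=1$, and for every $x\in E$ and $d>0$ with $B(x,d)\subset\mathcal{O}$ and every $y\in\widehat E$ there are words $w_j\in M^*$ with $r_{w_j}\to0$ and $$p_{w_j}^{-1}\,(f_{w_j}^{-1})_\sharp\bigl(\mu_{\mathbf p}\lfloor_{B(y,d\,r_{w_j})}\bigr)\xrightarrow[j\to\infty]{st}\mu_{\mathbf p}\lfloor_{B(x,d)} .$$ (iv)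 For every $R>0$, every $x\in\widehat E$ and every typical ball $B$ of radius at most $R$, the class of $\mu_{\mathbf p}\lfloor_B$ belongs to $\widetilde{Tan}^{st}_R(\mu_{\mathbf p},x)$. In particular, if all typical balls have radius at most $1$, then $\{\widetilde{\mu_{\mathbf p}\lfloor_B}: B \text{ typical}\}\subset\widetilde{Tan}^{st}(\mu_{\mathbf p},x)$ for every $x\in\widehat E$. -/

import Mathlib

open MeasureTheory Metric Filter Topology
open scoped NNReal ENNReal

noncomputable section

/-- Euclidean space `ℝⁿ`. -/
abbrev Eucl (n : ℕ) : Type := EuclideanSpace ℝ (Fin n)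

/-! ### Words, self-similar sets, feasible open sets -/

/-- `f_w = f_{w₁} ∘ f_{w₂} ∘ ⋯ ∘ f_{w_k}` for a finite word `w` (the product is composition in the
group of similitudes; the empty word gives the identity). -/
def wordMap {n m : ℕ} (f : Fin m → Eucl n ≃ᵈ Eucl n) (w : List (Fin m)) : Eucl n ≃ᵈ Eucl n :=
  (w.map f).prod

/-- `a_w = a_{w₁} a_{w₂} ⋯ a_{w_k}`, used for probability weights and for contraction ratios. -/
def wordProd {m : ℕ} (a : Fin m → ℝ≥0) (w : List (Fin m)) : ℝ≥0 :=
  (w.map a).prod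

/-- The contraction ratio `r_w` of `f_w`. -/
def wordRatio {n m : ℕ} (f : Fin m → Eucl n ≃ᵈ Eucl n) (w : List (Fin m)) : ℝ≥0 :=
  wordProd (fun i => Dilation.ratio (f i)) w

/-- `E` is the self-similar set generated by `f`: the non-empty compact set `E = ⋃ᵢ fᵢ(E)`. -/
structure IsSelfSimilarSet {n m : ℕ} (f : Fin m → Eucl n ≃ᵈ Eucl n) (E : Set (Eucl n)) :
    Prop where
  nonempty : E.Nonempty
  isCompact : IsCompact E
  eq_iUnion : E = ⋃ i, f i '' E

/-- `O` is a feasible open set for `f`, that is, it witnesses the open set condition. -/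
structure IsFeasible {n m : ℕ} (f : Fin m → Eucl n ≃ᵈ Eucl n) (O : Set (Eucl n)) : Prop where
  isOpen : IsOpen O
  nonempty : O.Nonempty
  image_subset : ∀ i, f i '' O ⊆ O
  disjoint : ∀ i j, i ≠ j → Disjoint (f i '' O) (f j '' O)

/-- The closed ball `B(x, d)`, `d > 0`, is typical: it is centred in `E` and contained in some
feasible open set. -/
def IsTypicalBall {n m : ℕ} (f : Fin m → Eucl n ≃ᵈ Eucl n) (E : Set (Eucl n))
    (x : Eucl n) (d : ℝ) : Prop :=
  0 < d ∧ x ∈ E ∧ ∃ O, IsFeasible f O ∧ closedBall x d ⊆ O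

/-- `μ` is the self-similar measure of `f` with weights `p`: the compactly supported Borel
probability measure fixed by the Markov operator, `μ = ∑ᵢ pᵢ (fᵢ)_♯ μ`. -/
structure IsSelfSimilarMeasure {n m : ℕ} (f : Fin m → Eucl n ≃ᵈ Eucl n) (p : Fin m → ℝ≥0)
    (μ : Measure (Eucl n)) : Prop where
  isProbabilityMeasure : IsProbabilityMeasure μ
  compactSupport : ∃ K, IsCompact K ∧ μ Kᶜ = 0
  fixed : μ = ∑ i, p i • μ.map (f i)

/-! ### The geometric shift -/

/-- The set `⋂ₖ f_{i₁⋯i_k}(E) = {π(i)}`, where `π` is the geometric projection of the code space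
onto `E`. -/
def codePoint {n m : ℕ} (f : Fin m → Eucl n ≃ᵈ Eucl n) (E : Set (Eucl n)) (i : ℕ → Fin m) :
    Set (Eucl n) :=
  ⋂ k : ℕ, wordMap f ((List.range k).map i) '' E

/-- The geometric shift `T = π ∘ σ ∘ π⁻¹` (a correspondence), acting on sets. -/
def geomShift {n m : ℕ} (f : Fin m → Eucl n ≃ᵈ Eucl n) (E A : Set (Eucl n)) : Set (Eucl n) :=
  {z | ∃ i : ℕ → Fin m, (codePoint f E i ∩ A).Nonempty ∧ z ∈ codePoint f E (fun k => i (k + 1))}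

/-- `Ê`: the points of `E` whose orbit `⋃_{k ≥ 1} Tᵏ(y)` is dense in `E`. -/
def denseOrbitSet {n m : ℕ} (f : Fin m → Eucl n ≃ᵈ Eucl n) (E : Set (Eucl n)) :
    Set (Eucl n) :=
  {y | y ∈ E ∧ E ⊆ closure (⋃ k : ℕ, (geomShift f E)^[k + 1] {y})}

/-! ### Strong convergence and classes of measures -/

/-- Strong (setwise) convergence of measures. -/
def StrongTendsto {n : ℕ} (α : ℕ → Measure (Eucl n)) (β : Measure (Eucl n)) : Prop :=
  ∀ A, MeasurableSet A → Tendsto (fun j => α j A) atTop (𝓝 (β A))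

/-- Radon measures on `ℝⁿ` (on this space: locally finite Borel measures). -/
abbrev RadonMeasure (n : ℕ) : Type := {α : Measure (Eucl n) // IsLocallyFiniteMeasure α}

/-- `α ≅ β` when `β = c g_♯ α` for some isometry `g` of `ℝⁿ` and some `c > 0`. -/
def MeasEquiv {n : ℕ} (α β : RadonMeasure n) : Prop :=
  ∃ (g : Eucl n ≃ᵢ Eucl n) (c : ℝ≥0), 0 < c ∧ β.1 = c • α.1.map g

theorem measEquiv_equivalence (n : ℕ) : Equivalence (MeasEquiv (n := n)) where
  refl α := ⟨IsometryEquiv.refl _, 1, one_pos, by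
    rw [one_smul]; exact Measure.map_id.symm⟩
  symm := by
    rintro α β ⟨g, c, hc, h⟩
    refine ⟨g.symm, c⁻¹, inv_pos.2 hc, ?_⟩
    rw [h, Measure.map_smul, smul_smul, inv_mul_cancel₀ hc.ne', one_smul,
      Measure.map_map g.symm.continuous.measurable g.continuous.measurable, show (g.symm : Eucl n → Eucl n) ∘ g = id from
        funext fun x => g.symm_apply_apply x, Measure.map_id]
  trans := by
    rintro α β γ ⟨g, c, hc, h⟩ ⟨g', c', hc', h'⟩
    refine ⟨g.trans g', c' * c, mul_pos hc' hc, ?_⟩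
    rw [h', h, Measure.map_smul, smul_smul,
      Measure.map_map g'.continuous.measurable g.continuous.measurable]
    rfl

/-- The setoid of `≅` on Radon measures. -/
def measSetoid (n : ℕ) : Setoid (RadonMeasure n) := ⟨MeasEquiv, measEquiv_equivalence n⟩

/-- Classes of Radon measures up to isometries and positive multiples. -/
abbrev MeasClass (n : ℕ) : Type := Quotient (measSetoid n)

/-- The class of a Radon measure. -/
def RadonMeasure.toClass {n : ℕ} (α : RadonMeasure n) : MeasClass n := Quotient.mk (measSetoid n) α

/-- The normalised zooming of `ν` at `x` by a similitude `g` of ratio `t`: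
`ν(B(x, d/t))⁻¹ g_♯(ν⌊B(x, d/t))`. -/
def zoom {n : ℕ} (ν : Measure (Eucl n)) (x : Eucl n) (d : ℝ) (g : Eucl n ≃ᵈ Eucl n) :
    Measure (Eucl n) :=
  (ν (closedBall x (d / Dilation.ratio g)))⁻¹ •
    (ν.restrict (closedBall x (d / Dilation.ratio g))).map g

/-- Strong tangent measure classes of `ν` at `x ∈ spt ν` with zooming windows of radius `d ≤ R`:
classes of the non-null Radon measures that are strong limits of `c_k • zoom ν x d g_k`, with
`c_k > 0`, similitudes `g_k` whose ratios tend to `∞`, and a fixed `0 < d ≤ R`. The customary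
normalisation is `R = 1`. -/
def strongTangentClasses {n : ℕ} (R : ℝ) (ν : Measure (Eucl n)) (x : Eucl n) :
    Set (MeasClass n) :=
  {C | x ∈ ν.support ∧ ∃ α : RadonMeasure n, α.toClass = C ∧ α.1 ≠ 0 ∧
    ∃ d : ℝ, 0 < d ∧ d ≤ R ∧ ∃ (c : ℕ → ℝ≥0) (g : ℕ → Eucl n ≃ᵈ Eucl n),
      (∀ k, 0 < c k) ∧ Tendsto (fun k => Dilation.ratio (g k)) atTop atTop ∧
      StrongTendsto (fun k => c k • zoom ν x d (g k)) α.1}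

/-- Classes of the typical spherical measures `μ⌊B`, `B` a typical ball of radius at most `R`. -/
def typicalClasses {n m : ℕ} (R : ℝ) (f : Fin m → Eucl n ≃ᵈ Eucl n) (E : Set (Eucl n))
    (μ : Measure (Eucl n)) : Set (MeasClass n) :=
  {C | ∃ α : RadonMeasure n, α.toClass = C ∧
    ∃ (z : Eucl n) (d : ℝ), IsTypicalBall f E z d ∧ d ≤ R ∧ α.1 = μ.restrict (closedBall z d)}

end

/-
A point `y` with a dense orbit can be written `y = f_w(z)` with `z` as close as we like to a given
`x ∈ E`. The scaling law `μ⌊f_w(B) = p_w (f_w)_♯(μ⌊B)` for `B ⊆ O` then identifies the rescaled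
restriction of `μ` at `y` with `μ⌊B(z, d)`, and `μ⌊B(z, d)` converges strongly to `μ⌊B(x, d)` as
`z → x` because `μ` does not charge the sphere `∂B(x, d)`. For the latter, the space of quadratic
polynomials restricted to `E` is finite-dimensional and preserved by composition with each `fᵢ`. The
zero set of a nonzero element has largest possible measure for some `q`, and then also for every
`q ∘ f_w`; were this measure positive, `q` would have zeros in every `f_w(E)`, hence vanish on `E`.
-/

theorem eq_of_sum_mul_eq_of_le {ι : Type*} [Fintype ι] {p : ι → ℝ≥0} (hp : ∀ i, 0 < p i)
    (hsum : ∑ i, p i = 1) {a : ι → ℝ≥0∞} {M : ℝ≥0∞} (hM : M ≠ ∞) (ha : ∀ i, a i ≤ M)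
    (h : ∑ i, p i * a i = M) (i : ι) : a i = M := by
  lift M to ℝ≥0 using hM
  lift a to ι → ℝ≥0 using fun i => ne_top_of_le_ne_top ENNReal.coe_ne_top (ha i)
  beta_reduce at ha h ⊢
  norm_cast at ha h ⊢
  have hle : ∀ i ∈ Finset.univ, (p i * a i : ℝ) ≤ p i * M := fun i _ => by gcongr; exact ha i
  have hterms := (Finset.sum_eq_sum_iff_of_le hle).1
    (by rw [← Finset.sum_mul]; norm_cast; rw [h, hsum, one_mul]) i (Finset.mem_univ i)
  exact mul_left_cancel₀ (hp i).ne' (mod_cast hterms)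

theorem tendsto_measure_lt_atTop {X : Type*} [MeasurableSpace X] (μ : Measure X)
    [IsFiniteMeasure μ] {g : X → ℝ} (hg : Measurable g) :
    Tendsto (fun t : ℝ => μ {x | t < g x}) atTop (𝓝 0) := by
  have hempty : ⋂ t : ℝ, {x | t < g x} = ∅ :=
    Set.eq_empty_of_forall_notMem fun x hx => lt_irrefl (g x) (Set.mem_iInter.1 hx (g x))
  rw [← measure_empty (μ := μ), ← hempty]
  exact tendsto_measure_iInter_atTop
    (fun t => (measurableSet_lt measurable_const hg).nullMeasurableSet)
    (fun s t hst x (hx : t < g x) => hst.trans_lt hx) ⟨0, measure_ne_top _ _⟩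

theorem eventually_closedBall_subset_of_isOpen {F : Type*} [NormedAddCommGroup F] [NormedSpace ℝ F]
    [ProperSpace F] {U : Set F} (hU : IsOpen U) {x : F} {d : ℝ} (hd : 0 ≤ d)
    (hxU : closedBall x d ⊆ U) : ∀ᶠ z in 𝓝 x, closedBall z d ⊆ U := by
  obtain ⟨δ, hδ, hδU⟩ := (isCompact_closedBall x d).exists_cthickening_subset_open hU hxU
  rw [cthickening_closedBall hδ.le hd] at hδU
  filter_upwards [closedBall_mem_nhds x hδ] with z hz
  exact (closedBall_subset_closedBall' (by rw [add_comm]; gcongr; exact hz)).trans hδU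

section Dilations

variable {X : Type*} [PseudoMetricSpace X] (g : X ≃ᵈ X)

theorem dilation_image_closedBall (z : X) (d : ℝ) :
    g '' closedBall z d = closedBall (g z) (d * Dilation.ratio g) := by
  have hpos : (0 : ℝ) < Dilation.ratio g := NNReal.coe_pos.2 (Dilation.ratio_pos g)
  ext x
  obtain ⟨y, rfl⟩ := g.surjective x
  rw [g.injective.mem_set_image, mem_closedBall, mem_closedBall, Dilation.dist_eq, mul_comm,
    mul_le_mul_iff_left₀ hpos]

theorem infDist_dilation_le {A : Set X} (hA : A.Nonempty) (hg : g '' A ⊆ A) (x : X) :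
    infDist (g x) A ≤ Dilation.ratio g * infDist x A := by
  have hpos : (0 : ℝ) < Dilation.ratio g := NNReal.coe_pos.2 (Dilation.ratio_pos g)
  rw [← div_le_iff₀' hpos]
  refine (le_infDist hA).2 fun y hy => ?_
  rw [div_le_iff₀' hpos, ← Dilation.dist_eq]
  exact infDist_le_dist_of_mem (hg ⟨y, hy, rfl⟩)

theorem dilation_measurableEmbedding [MeasurableSpace X] [BorelSpace X] :
    MeasurableEmbedding g :=
  g.toHomeomorph.measurableEmbedding

end Dilations

/-! ### Fixed points of the Markov operator -/

/-- `μ` is a fixed point of the Markov operator `μ ↦ ∑ᵢ pᵢ (φᵢ)_♯ μ`. Unlike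
`IsSelfSimilarMeasure`, this asks neither for total mass one nor for compact support, and it makes
sense for self-maps of any measurable space. -/
def IsMarkovInvariant {X ι : Type*} [MeasurableSpace X] [Fintype ι] (φ : ι → X → X) (p : ι → ℝ≥0)
    (μ : Measure X) : Prop :=
  μ = ∑ i, p i • μ.map (φ i)

namespace IsMarkovInvariant

variable {X ι : Type*} [MeasurableSpace X] [Fintype ι] {φ : ι → X → X} {p : ι → ℝ≥0}
  {μ : Measure X}

theorem apply_eq_sum (hμ : IsMarkovInvariant φ p μ) (A : Set X) :
    μ A = ∑ i, p i * μ.map (φ i) A := by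
  conv_lhs => rw [hμ]
  simp only [Measure.finsetSum_apply, Measure.smul_apply, ENNReal.smul_def, smul_eq_mul]

theorem measure_eq_sum (hμ : IsMarkovInvariant φ p μ) (hφ : ∀ i, Measurable (φ i)) {A : Set X}
    (hA : MeasurableSet A) : μ A = ∑ i, p i * μ (φ i ⁻¹' A) := by
  simpa only [fun i => Measure.map_apply (μ := μ) (hφ i) hA] using hμ.apply_eq_sum A

theorem measure_eq_sum_of_measurableEmbedding (hμ : IsMarkovInvariant φ p μ)
    (hφ : ∀ i, MeasurableEmbedding (φ i)) (A : Set X) : μ A = ∑ i, p i * μ (φ i ⁻¹' A) := by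
  simpa only [fun i => (hφ i).map_apply μ] using hμ.apply_eq_sum A

theorem sum_weights [IsFiniteMeasure μ] [NeZero μ] (hμ : IsMarkovInvariant φ p μ)
    (hφ : ∀ i, Measurable (φ i)) : ∑ i, p i = 1 := by
  have h := hμ.measure_eq_sum hφ MeasurableSet.univ
  simp only [Set.preimage_univ, ← Finset.sum_mul, ← ENNReal.ofNNReal_finsetSum] at h
  exact_mod_cast (ENNReal.mul_eq_right (Measure.measure_univ_ne_zero.2 (NeZero.ne μ))
    (measure_ne_top μ _)).1 h.symm

/-- If no preimage `φᵢ⁻¹(A)` has larger measure than `A`, the convex combination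
`μ A = ∑ᵢ pᵢ μ(φᵢ⁻¹ A)` forces equality throughout. -/
theorem measure_preimage_eq_of_forall_le [IsFiniteMeasure μ] (hμ : IsMarkovInvariant φ p μ)
    (hφ : ∀ i, Measurable (φ i)) (hp : ∀ i, 0 < p i) {A : Set X} (hA : MeasurableSet A)
    (hle : ∀ i, μ (φ i ⁻¹' A) ≤ μ A) (i : ι) : μ (φ i ⁻¹' A) = μ A := by
  rcases eq_zero_or_neZero μ with rfl | _
  · rfl
  · exact eq_of_sum_mul_eq_of_le hp (hμ.sum_weights hφ) (measure_ne_top μ A) hle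
      (hμ.measure_eq_sum hφ hA).symm i

theorem quasiMeasurePreserving (hμ : IsMarkovInvariant φ p μ) (hφ : ∀ i, Measurable (φ i))
    {i : ι} (hp : 0 < p i) : Measure.QuasiMeasurePreserving (φ i) μ μ := by
  refine ⟨hφ i, Measure.AbsolutelyContinuous.mk fun A _ hA0 => ?_⟩
  have h := Finset.sum_eq_zero_iff.1 ((hμ.apply_eq_sum A).symm.trans hA0) i (Finset.mem_univ i)
  exact (mul_eq_zero.1 h).resolve_left (ENNReal.coe_ne_zero.2 hp.ne')

theorem comap {Y : Type*} [MeasurableSpace Y] {ψ : ι → Y → Y} {j : Y → X}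
    (hμ : IsMarkovInvariant φ p μ) (hφ : ∀ i, Measurable (φ i)) (hψ : ∀ i, Measurable (ψ i))
    (hj : MeasurableEmbedding j) (hjψ : ∀ i, Function.Semiconj j (ψ i) (φ i))
    (hrange : μ (Set.range j)ᶜ = 0) : IsMarkovInvariant ψ p (μ.comap j) := by
  refine Measure.ext fun A hA => ?_
  simp only [Measure.finsetSum_apply, Measure.smul_apply, ENNReal.smul_def, smul_eq_mul,
    Measure.map_apply (hψ _) hA, hj.comap_apply]
  rw [hμ.measure_eq_sum hφ (hj.measurableSet_image.2 hA)]
  refine Finset.sum_congr rfl fun i _ => ?_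
  have hpre : φ i ⁻¹' (j '' A) ∩ Set.range j = j '' (ψ i ⁻¹' A) := by
    rw [← Set.image_preimage_eq_inter_range, ← Set.preimage_comp, ← (hjψ i).comp_eq,
      Set.preimage_comp, Set.preimage_image_eq _ hj.injective]
  rw [← measure_inter_conull hrange, hpre]

end IsMarkovInvariant

/-! ### Zero sets of functions in an invariant space -/

section ZeroSets

variable {X : Type*} [TopologicalSpace X] [CompactSpace X] [MeasurableSpace X] [BorelSpace X]

theorem upperSemicontinuous_measure_zeroSet (ν : Measure X) [IsFiniteMeasure ν] :
    UpperSemicontinuous fun q : C(X, ℝ) => ν {x | q x = 0} := by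
  intro q c hc
  have hzero : ⋂ ε > 0, {x | |q x| ≤ ε} = {x | q x = 0} := by
    ext x
    simp only [Set.mem_iInter, Set.mem_ofPred_eq, ← abs_nonpos_iff (a := q x)]
    exact forall_gt_imp_ge_iff_le_of_dense
  have hlim : Tendsto (fun ε : ℝ => ν {x | |q x| ≤ ε}) (𝓝[>] 0) (𝓝 (ν {x | q x = 0})) := by
    rw [← hzero]
    exact tendsto_measure_biInter_gt
      (fun ε _ => (isClosed_le (by fun_prop) continuous_const).nullMeasurableSet)
      (fun ε δ _ hεδ x (hx : |q x| ≤ ε) => hx.trans hεδ) ⟨1, one_pos, measure_ne_top _ _⟩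
  obtain ⟨ε, hεc, hε⟩ :=
    ((hlim.eventually_lt_const hc).and self_mem_nhdsWithin).exists
  filter_upwards [ball_mem_nhds q hε] with g hg
  refine (measure_mono fun x (hx : g x = 0) => ?_).trans_lt hεc
  have h := (ContinuousMap.dist_apply_le_dist (f := g) (g := q) x).trans (mem_ball.1 hg).le
  rwa [hx, Real.dist_eq, zero_sub, abs_neg] at h

theorem exists_max_measure_zeroSet (ν : Measure X) [IsFiniteMeasure ν]
    (Q : Submodule ℝ C(X, ℝ)) [FiniteDimensional ℝ Q] [Nontrivial Q] :
    ∃ q : Q, q ≠ 0 ∧ ∀ g : Q, g ≠ 0 → ν {x | g.1 x = 0} ≤ ν {x | q.1 x = 0} := by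
  have : ProperSpace Q := FiniteDimensional.proper_real Q
  have husc : UpperSemicontinuous fun q : Q => ν {x | q.1 x = 0} :=
    (upperSemicontinuous_measure_zeroSet ν).comp continuous_subtype_val
  obtain ⟨q, hq, hmax⟩ := (husc.upperSemicontinuousOn _).exists_isMaxOn
    (NormedSpace.sphere_nonempty.2 zero_le_one) (isCompact_sphere (0 : Q) 1)
  refine ⟨q, ne_zero_of_mem_unit_sphere ⟨q, hq⟩, fun g hg0 => ?_⟩
  have hnormalized : ‖g‖⁻¹ • g ∈ sphere (0 : Q) 1 := by
    exact mem_sphere_zero_iff_norm.2 (norm_smul_inv_norm (𝕜 := ℝ) hg0)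
  refine (measure_mono fun x (hx : g.1 x = 0) => ?_).trans (hmax hnormalized)
  simp [hx]

end ZeroSets

section InvariantSpaces

variable {X ι : Type*} [TopologicalSpace X] {φ : ι → C(X, X)} {Q : Submodule ℝ C(X, ℝ)}

theorem injOn_comp_of_map_eq [FiniteDimensional ℝ Q] {ψ : C(X, X)}
    (hQ : Q.map (ContinuousMap.compRightAlgHom ℝ ℝ ψ).toLinearMap = Q) :
    Set.InjOn (fun g : C(X, ℝ) => g.comp ψ) Q :=
  (LinearMap.injOn_iff_surjOn (f := (ContinuousMap.compRightAlgHom ℝ ℝ ψ).toLinearMap)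
    fun g hg => hQ.le ⟨g, hg, rfl⟩).2 fun _ hg => hQ.ge hg

variable [MeasurableSpace X] [BorelSpace X] [Fintype ι] {p : ι → ℝ≥0} {ν : Measure X}
  [IsFiniteMeasure ν]

/-- Composition with `φᵢ` preserves the nonzero elements of `Q`, so by maximality every term of
`ν {q = 0} = ∑ᵢ pᵢ ν {q ∘ φᵢ = 0}` is as large as the left-hand side. -/
theorem exists_zero_foldr_of_forall_le [FiniteDimensional ℝ Q]
    (hν : IsMarkovInvariant (fun i => φ i) p ν) (hp : ∀ i, 0 < p i)
    (hQ : ∀ i, Q.map (ContinuousMap.compRightAlgHom ℝ ℝ (φ i)).toLinearMap = Q)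
    {q : C(X, ℝ)} (hqQ : q ∈ Q) (hq0 : q ≠ 0) (hpos : ν {x | q x = 0} ≠ 0)
    (hmax : ∀ g ∈ Q, g ≠ 0 → ν {x | g x = 0} ≤ ν {x | q x = 0}) (w : List ι) :
    ∃ x, q (w.foldr (fun i => φ i) x) = 0 := by
  induction w generalizing q with
  | nil => exact nonempty_of_measure_ne_zero hpos
  | cons i _ ih =>
    have hcompQ : ∀ j, q.comp (φ j) ∈ Q := fun j => (hQ j).le ⟨q, hqQ, rfl⟩
    have hcomp0 : ∀ j, q.comp (φ j) ≠ 0 := fun j h =>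
      hq0 (injOn_comp_of_map_eq (hQ j) hqQ Q.zero_mem h)
    have hcompν : ν {x | q.comp (φ i) x = 0} = ν {x | q x = 0} :=
      hν.measure_preimage_eq_of_forall_le (fun j => (φ j).continuous.measurable) hp
        (isClosed_eq q.continuous continuous_const).measurableSet
        (fun j => hmax _ (hcompQ j) (hcomp0 j)) i
    exact ih (hcompQ i) (hcomp0 i) (hcompν ▸ hpos) (hcompν ▸ hmax)

/-- A nonzero element of `Q` whose zero set is as large as possible would, if that set were not
null, vanish somewhere on every set `φ_w(X)`, hence identically. -/
theorem measure_zeroSet_eq_zero [CompactSpace X] [FiniteDimensional ℝ Q]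
    (hν : IsMarkovInvariant (fun i => φ i) p ν) (hp : ∀ i, 0 < p i)
    (hQ : ∀ i, Q.map (ContinuousMap.compRightAlgHom ℝ ℝ (φ i)).toLinearMap = Q)
    (hsmall : ∀ U : Set X, IsOpen U → U.Nonempty →
      ∃ w : List ι, ∀ x, w.foldr (fun i => φ i) x ∈ U)
    {q : C(X, ℝ)} (hqQ : q ∈ Q) (hq0 : q ≠ 0) : ν {x | q x = 0} = 0 := by
  have : Nontrivial Q := ⟨⟨q, hqQ⟩, 0, fun h => hq0 (congrArg Subtype.val h)⟩
  obtain ⟨⟨g, hgQ⟩, hg0, hmax⟩ := exists_max_measure_zeroSet ν Q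
  replace hg0 : g ≠ 0 := fun h => hg0 (Subtype.ext h)
  replace hmax : ∀ h ∈ Q, h ≠ 0 → ν {x | h x = 0} ≤ ν {x | g x = 0} := fun h hhQ hh0 =>
    hmax ⟨h, hhQ⟩ fun h' => hh0 (congrArg Subtype.val h')
  suffices hg : ν {x | g x = 0} = 0 from le_zero_iff.1 (hg ▸ hmax q hqQ hq0)
  by_contra hpos
  obtain ⟨x, hx⟩ := DFunLike.ne_iff.1 hg0
  obtain ⟨w, hw⟩ := hsmall {x | g x ≠ 0} (isOpen_ne_fun g.continuous continuous_const) ⟨x, hx⟩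
  obtain ⟨y, hy⟩ := exists_zero_foldr_of_forall_le hν hp hQ hgQ hg0 hpos hmax w
  exact hw y hy

end InvariantSpaces

/-! ### Words and orbits of the geometric shift -/

section Words

variable {n m : ℕ} (f : Fin m → Eucl n ≃ᵈ Eucl n)

theorem wordMap_cons (i : Fin m) (w : List (Fin m)) :
    wordMap f (i :: w) = f i * wordMap f w := by
  rw [wordMap, List.map_cons, List.prod_cons, wordMap]

theorem wordMap_append (v w : List (Fin m)) : wordMap f (v ++ w) = wordMap f v * wordMap f w := by
  rw [wordMap, List.map_append, List.prod_append, wordMap, wordMap]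

theorem wordProd_cons (a : Fin m → ℝ≥0) (i : Fin m) (w : List (Fin m)) :
    wordProd a (i :: w) = a i * wordProd a w := by
  rw [wordProd, List.map_cons, List.prod_cons, wordProd]

theorem wordProd_pos {a : Fin m → ℝ≥0} (ha : ∀ i, 0 < a i) (w : List (Fin m)) :
    0 < wordProd a w :=
  List.prod_pos (by simpa only [List.forall_mem_map] using fun i _ => ha i)

theorem wordRatio_eq_ratio (w : List (Fin m)) :
    wordRatio f w = Dilation.ratio (wordMap f w) := by
  have h := (DilationEquiv.ratioHom (X := Eucl n)).map_list_prod (w.map f)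
  rw [List.map_map] at h
  exact h.symm

theorem wordRatio_pos (w : List (Fin m)) : 0 < wordRatio f w :=
  wordProd_pos (fun i => Dilation.ratio_pos (f i)) w

theorem wordRatio_le_pow {r : ℝ≥0} (hr : ∀ i, Dilation.ratio (f i) ≤ r) (w : List (Fin m)) :
    wordRatio f w ≤ r ^ w.length := by
  rw [wordRatio, wordProd, ← List.length_map (as := w) fun i => Dilation.ratio (f i)]
  exact List.prod_le_pow_card _ _ (by simpa only [List.forall_mem_map] using fun i _ => hr i)

variable {f}

theorem exists_ratio_le (hf : ∀ i, Dilation.ratio (f i) < 1) :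
    ∃ r : ℝ≥0, r < 1 ∧ ∀ i, Dilation.ratio (f i) ≤ r :=
  ⟨Finset.univ.sup fun i => Dilation.ratio (f i),
    (Finset.sup_lt_iff zero_lt_one).2 fun i _ => hf i,
    fun i => Finset.le_sup (f := fun i => Dilation.ratio (f i)) (Finset.mem_univ i)⟩

theorem tendsto_wordRatio_of_length (hf : ∀ i, Dilation.ratio (f i) < 1)
    {w : ℕ → List (Fin m)} (hw : ∀ j, j ≤ (w j).length) :
    Tendsto (fun j => wordRatio f (w j)) atTop (𝓝 0) := by
  obtain ⟨r, hr1, hr⟩ := exists_ratio_le hf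
  exact tendsto_of_tendsto_of_tendsto_of_le_of_le tendsto_const_nhds
    (tendsto_pow_atTop_nhds_zero_of_lt_one zero_le hr1) (fun _ => zero_le)
    fun j => (wordRatio_le_pow f hr (w j)).trans (pow_le_pow_of_le_one zero_le hr1.le (hw j))

theorem tendsto_wordRatio_mul_of_length (hf : ∀ i, Dilation.ratio (f i) < 1)
    {w : ℕ → List (Fin m)} (hw : ∀ j, j ≤ (w j).length) (c : ℝ) :
    Tendsto (fun j => wordRatio f (w j) * c) atTop (𝓝 0) := by
  simpa only [NNReal.coe_zero, zero_mul] using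
    (NNReal.tendsto_coe.2 (tendsto_wordRatio_of_length hf hw)).mul_const c

theorem mapsTo_wordMap {A : Set (Eucl n)} (hA : ∀ i, Set.MapsTo (f i) A A) (w : List (Fin m)) :
    Set.MapsTo (wordMap f w) A A := by
  induction w with
  | nil => exact Set.mapsTo_id A
  | cons i w ih => rw [wordMap_cons]; exact (hA i).comp ih

/-- The points reached from `K` by non-empty words, `⋃_{w ≠ ∅} f_w(K)`. -/
def forwardOrbit (f : Fin m → Eucl n ≃ᵈ Eucl n) (K : Set (Eucl n)) : Set (Eucl n) :=
  ⋃ (w : List (Fin m)) (_ : w ≠ []), wordMap f w '' K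

theorem mem_forwardOrbit {K : Set (Eucl n)} {y : Eucl n} :
    y ∈ forwardOrbit f K ↔ ∃ w : List (Fin m), w ≠ [] ∧ ∃ x ∈ K, wordMap f w x = y := by
  simp only [forwardOrbit, Set.mem_iUnion, exists_prop, Set.mem_image]

theorem forwardOrbit_mono {K L : Set (Eucl n)} (h : K ⊆ L) : forwardOrbit f K ⊆ forwardOrbit f L :=
  Set.iUnion₂_mono fun _ _ => Set.image_mono h

theorem mapsTo_forwardOrbit (i : Fin m) (K : Set (Eucl n)) :
    Set.MapsTo (f i) (forwardOrbit f K) (forwardOrbit f K) := by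
  intro y hy
  obtain ⟨w, -, x, hx, rfl⟩ := mem_forwardOrbit.1 hy
  exact mem_forwardOrbit.2 ⟨i :: w, List.cons_ne_nil i w, x, hx, by
    rw [wordMap_cons, DilationEquiv.coe_mul, Function.comp_apply]⟩

end Words

theorem IsFeasible.mapsTo {n m : ℕ} {f : Fin m → Eucl n ≃ᵈ Eucl n} {O : Set (Eucl n)}
    (hO : IsFeasible f O) (i : Fin m) : Set.MapsTo (f i) O O :=
  Set.mapsTo_iff_image_subset.2 (hO.image_subset i)

namespace IsSelfSimilarSet

variable {n m : ℕ} {f : Fin m → Eucl n ≃ᵈ Eucl n} {E : Set (Eucl n)}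

theorem mapsTo (hE : IsSelfSimilarSet f E) (i : Fin m) : Set.MapsTo (f i) E E := by
  intro x hx
  rw [hE.eq_iUnion]
  exact Set.mem_iUnion.2 ⟨i, x, hx, rfl⟩

theorem exists_apply_eq (hE : IsSelfSimilarSet f E) {x : Eucl n} (hx : x ∈ E) :
    ∃ i, ∃ y ∈ E, f i y = x := by
  rw [hE.eq_iUnion] at hx
  exact Set.mem_iUnion.1 hx

theorem exists_wordMap_eq (hE : IsSelfSimilarSet f E) (k : ℕ) {x : Eucl n} (hx : x ∈ E) :
    ∃ w : List (Fin m), w.length = k ∧ ∃ y ∈ E, wordMap f w y = x := by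
  induction k generalizing x with
  | zero => exact ⟨[], rfl, x, hx, rfl⟩
  | succ k ih =>
    obtain ⟨i, y, hy, rfl⟩ := hE.exists_apply_eq hx
    obtain ⟨w, rfl, z, hz, rfl⟩ := ih hy
    exact ⟨i :: w, rfl, z, hz, by rw [wordMap_cons, DilationEquiv.coe_mul, Function.comp_apply]⟩

theorem dist_wordMap_le (hE : IsSelfSimilarSet f E) (w : List (Fin m)) {x y : Eucl n}
    (hx : x ∈ E) (hy : y ∈ E) :
    dist (wordMap f w x) (wordMap f w y) ≤ wordRatio f w * diam E := by
  rw [Dilation.dist_eq, wordRatio_eq_ratio]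
  gcongr
  exact dist_le_diam_of_mem hE.isCompact.isBounded hx hy

theorem exists_wordMap_image_subset (hE : IsSelfSimilarSet f E)
    (hf : ∀ i, Dilation.ratio (f i) < 1) {x : Eucl n} (hx : x ∈ E) {U : Set (Eucl n)}
    (hU : U ∈ 𝓝 x) : ∃ w : List (Fin m), wordMap f w '' E ⊆ U := by
  obtain ⟨ε, hε, hεU⟩ := Metric.mem_nhds_iff.1 hU
  choose w hw y hy hwy using fun k => hE.exists_wordMap_eq k hx
  have hlim := tendsto_wordRatio_mul_of_length hf (fun k => (hw k).ge) (diam E)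
  obtain ⟨k, hk⟩ := (hlim.eventually_lt_const hε).exists
  refine ⟨w k, Set.image_subset_iff.2 fun z hz => hεU (mem_ball.2 ?_)⟩
  rw [← hwy k]
  exact (hE.dist_wordMap_le (w k) hz (hy k)).trans_lt hk

theorem subset_closure (hE : IsSelfSimilarSet f E) (hf : ∀ i, Dilation.ratio (f i) < 1)
    {A : Set (Eucl n)} (hA : A.Nonempty) (hmaps : ∀ i, Set.MapsTo (f i) A A) :
    E ⊆ closure A := by
  obtain ⟨x, hx, hmax⟩ := hE.isCompact.exists_isMaxOn hE.nonempty
    (continuous_infDist_pt A).continuousOn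
  obtain ⟨i, y, hy, rfl⟩ := hE.exists_apply_eq hx
  have hcontract : infDist (f i y) A ≤ Dilation.ratio (f i) * infDist (f i y) A :=
    (infDist_dilation_le (f i) hA (hmaps i).image_subset y).trans (by gcongr; exact hmax hy)
  have hzero : infDist (f i y) A = 0 := by
    by_contra hne
    exact hcontract.not_gt
      (mul_lt_of_lt_one_left (infDist_nonneg.lt_of_ne' hne) (mod_cast hf i))
  exact fun z hz => (mem_closure_iff_infDist_zero hA).2
    (infDist_nonneg.antisymm' ((hmax hz).trans hzero.le))

theorem exists_mem_codePoint (hE : IsSelfSimilarSet f E) {x : Eucl n} (hx : x ∈ E) :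
    ∃ i : ℕ → Fin m, x ∈ codePoint f E i := by
  choose g s hs hgs using fun x : E => hE.exists_apply_eq x.2
  let S : E → E := fun x => ⟨s x, hs x⟩
  refine ⟨fun k => g (S^[k] ⟨x, hx⟩), Set.mem_iInter.2 fun k =>
    ⟨S^[k] ⟨x, hx⟩, Subtype.coe_prop _, ?_⟩⟩
  induction k with
  | zero => rfl
  | succ k ih =>
    rw [List.range_succ, List.map_append, wordMap_append, List.map_singleton,
      Function.iterate_succ_apply']
    exact (congrArg _ (hgs _)).trans ih

theorem apply_mem_codePoint (hE : IsSelfSimilarSet f E) {i : ℕ → Fin m} {z : Eucl n}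
    (hz : z ∈ codePoint f E fun k => i (k + 1)) : f (i 0) z ∈ codePoint f E i := by
  rw [codePoint, Set.mem_iInter] at hz ⊢
  intro k
  cases k with
  | zero =>
    obtain ⟨y, hy, rfl⟩ := hz 0
    exact ⟨f (i 0) y, hE.mapsTo _ hy, rfl⟩
  | succ k =>
    obtain ⟨y, hy, hyz⟩ := hz k
    refine ⟨y, hy, ?_⟩
    rw [List.range_succ_eq_map, List.map_cons, List.map_map, wordMap_cons]
    exact congrArg _ hyz

theorem codePoint_subsingleton (hE : IsSelfSimilarSet f E) (hf : ∀ i, Dilation.ratio (f i) < 1)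
    (i : ℕ → Fin m) : (codePoint f E i).Subsingleton := by
  intro x hx y hy
  have hlim := tendsto_wordRatio_mul_of_length hf (w := fun k => (List.range k).map i)
    (fun k => by rw [List.length_map, List.length_range]) (diam E)
  refine dist_le_zero.1 (ge_of_tendsto' hlim fun k => ?_)
  obtain ⟨x', hx', rfl⟩ := Set.mem_iInter.1 hx k
  obtain ⟨y', hy', rfl⟩ := Set.mem_iInter.1 hy k
  exact hE.dist_wordMap_le _ hx' hy'

theorem mem_geomShift_iff (hE : IsSelfSimilarSet f E) (hf : ∀ i, Dilation.ratio (f i) < 1)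
    {A : Set (Eucl n)} {z : Eucl n} :
    z ∈ geomShift f E A ↔ z ∈ E ∧ ∃ i, f i z ∈ A := by
  constructor
  · rintro ⟨i, ⟨y, hy, hyA⟩, hz⟩
    obtain ⟨x, hx, rfl⟩ := Set.mem_iInter.1 hz 0
    refine ⟨hx, i 0, ?_⟩
    rwa [hE.codePoint_subsingleton hf i (hE.apply_mem_codePoint hz) hy]
  · rintro ⟨hz, j, hj⟩
    obtain ⟨i, hi⟩ := hE.exists_mem_codePoint hz
    let i' : ℕ → Fin m := fun k => Nat.casesOn k j i
    exact ⟨i', ⟨f j z, hE.apply_mem_codePoint (i := i') hi, hj⟩, hi⟩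

theorem mem_iterate_geomShift_iff (hE : IsSelfSimilarSet f E)
    (hf : ∀ i, Dilation.ratio (f i) < 1) {k : ℕ} {A : Set (Eucl n)} {z : Eucl n} (hz : z ∈ E) :
    z ∈ (geomShift f E)^[k] A ↔ ∃ w : List (Fin m), w.length = k ∧ wordMap f w z ∈ A := by
  induction k generalizing A with
  | zero =>
    simp only [Function.iterate_zero_apply, List.length_eq_zero_iff, exists_eq_left]
    rfl
  | succ k ih =>
    rw [Function.iterate_succ_apply, ih]
    simp only [hE.mem_geomShift_iff hf, mapsTo_wordMap hE.mapsTo _ hz, true_and]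
    constructor
    · rintro ⟨w, rfl, i, hi⟩
      exact ⟨i :: w, rfl, by rwa [wordMap_cons]⟩
    · rintro ⟨_ | ⟨i, w⟩, hw, hwz⟩
      · exact absurd hw.symm (Nat.succ_ne_zero k)
      · rw [wordMap_cons] at hwz
        exact ⟨w, Nat.succ.inj hw, i, hwz⟩

theorem mem_iUnion_iterate_geomShift_iff (hE : IsSelfSimilarSet f E)
    (hf : ∀ i, Dilation.ratio (f i) < 1) {y z : Eucl n} :
    z ∈ ⋃ k : ℕ, (geomShift f E)^[k + 1] {y} ↔
      z ∈ E ∧ ∃ w : List (Fin m), w ≠ [] ∧ wordMap f w z = y := by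
  rw [Set.mem_iUnion]
  constructor
  · rintro ⟨k, hk⟩
    have hz : z ∈ E := ((hE.mem_geomShift_iff hf).1 (Function.iterate_succ_apply' _ k _ ▸ hk)).1
    obtain ⟨w, hw, hwz⟩ := (hE.mem_iterate_geomShift_iff hf hz).1 hk
    exact ⟨hz, w, List.ne_nil_of_length_eq_add_one hw, hwz⟩
  · rintro ⟨hz, w, hw, hwz⟩
    refine ⟨w.length - 1, (hE.mem_iterate_geomShift_iff hf hz).2 ⟨w, ?_, hwz⟩⟩
    exact (Nat.sub_add_cancel (List.length_pos_iff.2 hw)).symm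

theorem mem_denseOrbitSet_iff (hE : IsSelfSimilarSet f E) (hf : ∀ i, Dilation.ratio (f i) < 1)
    {y : Eucl n} : y ∈ denseOrbitSet f E ↔
      y ∈ E ∧ ∀ x ∈ E, ∀ U ∈ 𝓝 x, y ∈ forwardOrbit f (U ∩ E) := by
  refine and_congr_right fun _ => forall₂_congr fun x _ => ?_
  rw [mem_closure_iff_nhds]
  refine forall₂_congr fun U _ => ?_
  simp only [Set.Nonempty, Set.mem_inter_iff, hE.mem_iUnion_iterate_geomShift_iff hf,
    mem_forwardOrbit]
  exact ⟨fun ⟨z, hzU, hzE, w, hw, hwz⟩ => ⟨w, hw, z, ⟨hzU, hzE⟩, hwz⟩,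
    fun ⟨w, hw, z, ⟨hzU, hzE⟩, hwz⟩ => ⟨z, hzU, hzE, w, hw, hwz⟩⟩

theorem mem_denseOrbitSet_of_forall (hE : IsSelfSimilarSet f E)
    (hf : ∀ i, Dilation.ratio (f i) < 1) {y : Eucl n} (hy : y ∈ E)
    (horbit : ∀ v, y ∈ forwardOrbit f (wordMap f v '' E)) : y ∈ denseOrbitSet f E := by
  refine (hE.mem_denseOrbitSet_iff hf).2 ⟨hy, fun x hx U hU => ?_⟩
  obtain ⟨v, hv⟩ := hE.exists_wordMap_image_subset hf hx hU
  exact forwardOrbit_mono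
    (Set.subset_inter hv (mapsTo_wordMap hE.mapsTo v).image_subset) (horbit v)

end IsSelfSimilarSet

/-! ### Invariant measures on self-similar sets -/

namespace IsMarkovInvariant

variable {n m : ℕ} {f : Fin m → Eucl n ≃ᵈ Eucl n} {E O : Set (Eucl n)} {p : Fin m → ℝ≥0}
  {μ : Measure (Eucl n)}

theorem quasiMeasurePreserving_wordMap (hμ : IsMarkovInvariant (fun i => f i) p μ)
    (hp : ∀ i, 0 < p i) (w : List (Fin m)) :
    Measure.QuasiMeasurePreserving (wordMap f w) μ μ := by
  induction w with
  | nil => exact Measure.QuasiMeasurePreserving.id μ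
  | cons i w ih =>
    rw [wordMap_cons]
    exact (hμ.quasiMeasurePreserving
      (fun i => (dilation_measurableEmbedding (f i)).measurable) (hp i)).comp ih

variable [IsProbabilityMeasure μ]

theorem measure_mul_lt_infDist_le (hμ : IsMarkovInvariant (fun i => f i) p μ) {r : ℝ≥0}
    (hr : ∀ i, Dilation.ratio (f i) ≤ r) {A : Set (Eucl n)} (hA : A.Nonempty)
    (hmaps : ∀ i, Set.MapsTo (f i) A A) (t : ℝ) :
    μ {x | r * t < infDist x A} ≤ μ {x | t < infDist x A} := by
  have hsub : ∀ i, f i ⁻¹' {x | r * t < infDist x A} ⊆ {x | t < infDist x A} := by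
    intro i x (hx : r * t < infDist (f i x) A)
    refine lt_of_mul_lt_mul_left (hx.trans_le ?_) r.coe_nonneg
    refine (infDist_dilation_le (f i) hA (hmaps i).image_subset x).trans ?_
    gcongr
    · exact infDist_nonneg
    · exact hr i
  calc μ {x | r * t < infDist x A}
      = ∑ i, p i * μ (f i ⁻¹' {x | r * t < infDist x A}) :=
        hμ.measure_eq_sum_of_measurableEmbedding (fun i => dilation_measurableEmbedding (f i)) _
    _ ≤ ∑ i, p i * μ {x | t < infDist x A} := by gcongr with i; exact hsub i
    _ = μ {x | t < infDist x A} := by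
        rw [← Finset.sum_mul, ← ENNReal.ofNNReal_finsetSum,
          hμ.sum_weights fun i => (dilation_measurableEmbedding (f i)).measurable,
          ENNReal.coe_one, one_mul]

/-- Since the `f i` contract, the measure of `{x | t < infDist x A}` does not decrease when `t` is
replaced by `r ^ k * t`, and it tends to `0` as `t → ∞`. -/
theorem measure_compl_eq_zero (hμ : IsMarkovInvariant (fun i => f i) p μ)
    (hf : ∀ i, Dilation.ratio (f i) < 1) {A : Set (Eucl n)} (hA : A.Nonempty)
    (hclosed : IsClosed A) (hmaps : ∀ i, Set.MapsTo (f i) A A) : μ Aᶜ = 0 := by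
  obtain ⟨r, hr1, hr⟩ := exists_ratio_le hf
  have hpow : ∀ (k : ℕ) (t : ℝ), μ {x | r ^ k * t < infDist x A} ≤ μ {x | t < infDist x A} := by
    intro k t
    induction k with
    | zero => simp only [pow_zero, one_mul, le_refl]
    | succ k ih =>
      simp only [pow_succ', mul_assoc]
      exact (hμ.measure_mul_lt_infDist_le hr hA hmaps _).trans ih
  have hfar : ∀ ε > 0, μ {x | ε < infDist x A} = 0 := by
    intro ε hε
    refine le_zero_iff.1 (ge_of_tendsto'
      (tendsto_measure_lt_atTop μ (continuous_infDist_pt A).measurable) fun t => ?_)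
    have hlim : Tendsto (fun k : ℕ => (r : ℝ) ^ k * t) atTop (𝓝 0) := by
      simpa only [zero_mul] using (tendsto_pow_atTop_nhds_zero_of_lt_one r.coe_nonneg
        (mod_cast hr1 : (r : ℝ) < 1)).mul_const t
    obtain ⟨k, hk⟩ := (hlim.eventually_lt_const hε).exists
    exact (measure_mono fun x (hx : ε < infDist x A) => hk.trans hx).trans (hpow k t)
  refine measure_mono_null (fun x hx => ?_)
    (measure_iUnion_null fun k : ℕ => hfar (1 / (k + 1)) Nat.one_div_pos_of_nat)
  exact Set.mem_iUnion.2
    (exists_nat_one_div_lt ((hclosed.notMem_iff_infDist_pos hA).1 hx))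

theorem measure_compl_selfSimilarSet (hμ : IsMarkovInvariant (fun i => f i) p μ)
    (hE : IsSelfSimilarSet f E) (hf : ∀ i, Dilation.ratio (f i) < 1) : μ Eᶜ = 0 :=
  hμ.measure_compl_eq_zero hf hE.nonempty hE.isCompact.isClosed hE.mapsTo

theorem subset_support (hμ : IsMarkovInvariant (fun i => f i) p μ) (hE : IsSelfSimilarSet f E)
    (hf : ∀ i, Dilation.ratio (f i) < 1) (hp : ∀ i, 0 < p i) : E ⊆ μ.support := by
  intro x hx
  refine (Measure.mem_support_iff_forall x).2 fun U hU => pos_iff_ne_zero.2 fun hU0 => ?_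
  obtain ⟨w, hw⟩ := hE.exists_wordMap_image_subset hf hx hU
  have hE0 : μ E = 0 := measure_mono_null (Set.image_subset_iff.1 hw)
    ((hμ.quasiMeasurePreserving_wordMap hp w).preimage_null hU0)
  rw [measure_of_measure_compl_eq_zero (hμ.measure_compl_selfSimilarSet hE hf), measure_univ] at hE0
  exact one_ne_zero hE0

theorem wordMap_preimage_ae_eq (hμ : IsMarkovInvariant (fun i => f i) p μ) (hp : ∀ i, 0 < p i)
    {A : Set (Eucl n)} (hA : MeasurableSet A) (hsub : ∀ i, f i ⁻¹' A ⊆ A) (w : List (Fin m)) :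
    wordMap f w ⁻¹' A =ᵐ[μ] A := by
  have hmeas : ∀ i, Measurable (f i) := fun i => (dilation_measurableEmbedding (f i)).measurable
  have hletter : ∀ i, f i ⁻¹' A =ᵐ[μ] A := fun i =>
    ae_eq_of_subset_of_measure_ge (hsub i)
      (hμ.measure_preimage_eq_of_forall_le hmeas hp hA (fun j => measure_mono (hsub j)) i).ge
      (hmeas i hA).nullMeasurableSet (measure_ne_top μ A)
  induction w with
  | nil => rfl
  | cons i w ih =>
    rw [wordMap_cons, DilationEquiv.coe_mul, Set.preimage_comp]
    exact ((hμ.quasiMeasurePreserving_wordMap hp w).preimage_ae_eq (hletter i)).trans ih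

theorem measure_compl_eq_zero_of_mapsTo_wordMap (hμ : IsMarkovInvariant (fun i => f i) p μ)
    (hE : IsSelfSimilarSet f E) (hf : ∀ i, Dilation.ratio (f i) < 1) (hp : ∀ i, 0 < p i)
    {G : Set (Eucl n)} (hG : MeasurableSet G) (hmaps : ∀ i, Set.MapsTo (f i) G G)
    {w : List (Fin m)} (hw : Set.MapsTo (wordMap f w) E G) : μ Gᶜ = 0 := by
  rw [← measure_congr (hμ.wordMap_preimage_ae_eq hp hG.compl
    (fun i x hx hxG => hx (hmaps i hxG)) w)]
  exact measure_mono_null (fun x hx hxE => hx (hw hxE)) (hμ.measure_compl_selfSimilarSet hE hf)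

/-- The orbit of `f_v(E)` is forward invariant, hence invariant under preimages up to null sets, and
`f_w` maps all of `E` into it for `w = i v`. There are only countably many words `v`. -/
theorem measure_compl_denseOrbitSet (hμ : IsMarkovInvariant (fun i => f i) p μ)
    (hE : IsSelfSimilarSet f E) (hf : ∀ i, Dilation.ratio (f i) < 1) (hp : ∀ i, 0 < p i) :
    μ (denseOrbitSet f E)ᶜ = 0 := by
  obtain ⟨x, hx⟩ := hE.nonempty
  obtain ⟨i, -⟩ := hE.exists_apply_eq hx
  have horbit : ∀ v, μ (forwardOrbit f (wordMap f v '' E))ᶜ = 0 := fun v => by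
    refine hμ.measure_compl_eq_zero_of_mapsTo_wordMap hE hf hp (w := i :: v) ?_
      (fun j => mapsTo_forwardOrbit j _) fun y hy => ?_
    · exact MeasurableSet.iUnion fun w => MeasurableSet.iUnion fun _ =>
        (dilation_measurableEmbedding _).measurableSet_image.2
          ((dilation_measurableEmbedding _).measurableSet_image.2 hE.isCompact.measurableSet)
    · rw [wordMap_cons]
      exact mem_forwardOrbit.2 ⟨[i], List.cons_ne_nil i [], _, ⟨y, hy, rfl⟩, rfl⟩
  refine measure_mono_null (fun y hy => ?_)
    (measure_union_null (hμ.measure_compl_selfSimilarSet hE hf) (measure_iUnion_null horbit))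
  contrapose! hy
  simp only [Set.mem_union, Set.mem_iUnion, Set.mem_compl_iff, not_or, not_not, not_exists] at hy
  exact not_not.2 (hE.mem_denseOrbitSet_of_forall hf hy.1 hy.2)

/-- For `j ≠ i` the open set `f_j⁻¹(f_i(O))` misses `O`, hence also `E ⊆ closure O`, so only one
term of `μ (f_i(S)) = ∑ⱼ pⱼ μ (f_j⁻¹(f_i(S)))` survives. -/
theorem measure_image_of_subset (hμ : IsMarkovInvariant (fun i => f i) p μ)
    (hE : IsSelfSimilarSet f E) (hf : ∀ i, Dilation.ratio (f i) < 1) (hO : IsFeasible f O)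
    (i : Fin m) {S : Set (Eucl n)} (hS : S ⊆ O) : μ (f i '' S) = p i * μ S := by
  have hcross : ∀ j, j ≠ i → μ (f j ⁻¹' (f i '' S)) = 0 := by
    refine fun j hj => measure_mono_null (t := Eᶜ) (fun x hx hxE => ?_)
      (hμ.measure_compl_selfSimilarSet hE hf)
    have hopen : IsOpen (f j ⁻¹' (f i '' O)) :=
      ((f i).toHomeomorph.isOpenMap O hO.isOpen).preimage (f j).toHomeomorph.continuous
    obtain ⟨y, hy, hyO⟩ := mem_closure_iff.1 (hE.subset_closure hf hO.nonempty hO.mapsTo hxE) _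
      hopen (Set.image_mono hS hx)
    exact (hO.disjoint i j hj.symm).notMem_of_mem_left hy ⟨y, hyO, rfl⟩
  rw [hμ.measure_eq_sum_of_measurableEmbedding fun j => dilation_measurableEmbedding (f j),
    Fintype.sum_eq_single i fun j hj => by rw [hcross j hj, mul_zero],
    Set.preimage_image_eq _ (f i).injective]

theorem measure_wordMap_image (hμ : IsMarkovInvariant (fun i => f i) p μ)
    (hE : IsSelfSimilarSet f E) (hf : ∀ i, Dilation.ratio (f i) < 1) (hO : IsFeasible f O)
    (w : List (Fin m)) {S : Set (Eucl n)} (hS : S ⊆ O) :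
    μ (wordMap f w '' S) = wordProd p w * μ S := by
  induction w with
  | nil => simp [wordProd, wordMap]
  | cons i w ih =>
    rw [wordMap_cons, DilationEquiv.coe_mul, Set.image_comp, wordProd_cons, ENNReal.coe_mul,
      mul_assoc, ← ih]
    exact hμ.measure_image_of_subset hE hf hO i
      ((mapsTo_wordMap hO.mapsTo w).mono_left hS).image_subset

theorem restrict_wordMap_image (hμ : IsMarkovInvariant (fun i => f i) p μ)
    (hE : IsSelfSimilarSet f E) (hf : ∀ i, Dilation.ratio (f i) < 1) (hO : IsFeasible f O)
    (w : List (Fin m)) {B : Set (Eucl n)} (hB : B ⊆ O) :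
    μ.restrict (wordMap f w '' B) = wordProd p w • (μ.restrict B).map (wordMap f w) := by
  have hw := dilation_measurableEmbedding (wordMap f w)
  ext A hA
  rw [Measure.smul_apply, hw.map_apply, Measure.restrict_apply hA,
    Measure.restrict_apply (hw.measurable hA), Set.inter_comm A, ← Set.image_inter_preimage,
    Set.inter_comm B, hμ.measure_wordMap_image hE hf hO w (Set.inter_subset_right.trans hB),
    ENNReal.smul_def, smul_eq_mul]

theorem restrict_eq_map_symm (hμ : IsMarkovInvariant (fun i => f i) p μ)
    (hE : IsSelfSimilarSet f E) (hf : ∀ i, Dilation.ratio (f i) < 1) (hO : IsFeasible f O)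
    (hp : ∀ i, 0 < p i) (w : List (Fin m)) {B : Set (Eucl n)} (hB : B ⊆ O) :
    μ.restrict B =
      (wordProd p w)⁻¹ • (μ.restrict (wordMap f w '' B)).map (wordMap f w).symm := by
  rw [hμ.restrict_wordMap_image hE hf hO w hB, Measure.map_smul,
    inv_smul_smul₀ (wordProd_pos hp w).ne',
    Measure.map_map (dilation_measurableEmbedding _).measurable
      (dilation_measurableEmbedding _).measurable,
    Function.LeftInverse.comp_eq_id (wordMap f w).symm_apply_apply, Measure.map_id]

end IsMarkovInvariant

/-! ### Measure of spheres -/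

section SquaredDistances

variable {X : Type*} [PseudoMetricSpace X]

/-- The function `y ↦ d(y, c)²` on a subset `E` of a metric space. -/
noncomputable def sqDistMap (E : Set X) (c : X) : C(E, ℝ) :=
  ⟨fun y => dist (y : X) c ^ 2, by fun_prop⟩

/-- The functions on `E` spanned by the constants and the squared distances to points of the
ambient space. In `ℝⁿ` these are restrictions of quadratic polynomials, and a function whose zero
set is a given sphere is among them. -/
noncomputable def sqDistSpan (E : Set X) : Submodule ℝ C(E, ℝ) :=
  Submodule.span ℝ (insert 1 (Set.range (sqDistMap E)))

theorem one_mem_sqDistSpan (E : Set X) : 1 ∈ sqDistSpan E :=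
  Submodule.subset_span (Set.mem_insert _ _)

theorem sqDistMap_mem_sqDistSpan (E : Set X) (c : X) : sqDistMap E c ∈ sqDistSpan E :=
  Submodule.subset_span (Set.mem_insert_of_mem _ ⟨c, rfl⟩)

variable {E : Set X} {g : X ≃ᵈ X} {ψ : C(E, E)}

theorem sqDistMap_comp_dilation (hψ : ∀ y, (ψ y : X) = g y) (c : X) :
    (sqDistMap E (g c)).comp ψ = (Dilation.ratio g : ℝ) ^ 2 • sqDistMap E c := by
  ext y
  simp only [sqDistMap, ContinuousMap.comp_apply, ContinuousMap.coe_mk, ContinuousMap.smul_apply,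
    hψ, Dilation.dist_eq, mul_pow, smul_eq_mul]

theorem map_sqDistSpan_comp_dilation (hψ : ∀ y, (ψ y : X) = g y) :
    (sqDistSpan E).map (ContinuousMap.compRightAlgHom ℝ ℝ ψ).toLinearMap = sqDistSpan E := by
  have hr : (Dilation.ratio g : ℝ) ^ 2 ≠ 0 :=
    pow_ne_zero 2 (NNReal.coe_ne_zero.2 (Dilation.ratio_ne_zero g))
  refine le_antisymm (Submodule.map_le_iff_le_comap.2 (Submodule.span_le.2 ?_))
    (Submodule.span_le.2 ?_)
  · rintro _ (rfl | ⟨c, rfl⟩)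
    · exact one_mem_sqDistSpan E
    · obtain ⟨c, rfl⟩ := g.surjective c
      change (sqDistMap E (g c)).comp ψ ∈ sqDistSpan E
      rw [sqDistMap_comp_dilation hψ]
      exact Submodule.smul_mem _ _ (sqDistMap_mem_sqDistSpan E c)
  · rintro _ (rfl | ⟨c, rfl⟩)
    · exact ⟨1, one_mem_sqDistSpan E, rfl⟩
    · refine ⟨((Dilation.ratio g : ℝ) ^ 2)⁻¹ • sqDistMap E (g c),
        Submodule.smul_mem _ _ (sqDistMap_mem_sqDistSpan E (g c)), ?_⟩
      change ((Dilation.ratio g : ℝ) ^ 2)⁻¹ • (sqDistMap E (g c)).comp ψ = _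
      rw [sqDistMap_comp_dilation hψ, inv_smul_smul₀ hr]

variable {F : Type*} [NormedAddCommGroup F] [InnerProductSpace ℝ F]

/-- The restriction to `E` of the quadratic polynomial `y ↦ a|y|² + ⟨b, y⟩ + c`, as a linear
function of its coefficients `(a, b, c)`. -/
noncomputable def quadraticMap (E : Set F) : (ℝ × F × ℝ) →ₗ[ℝ] C(E, ℝ) where
  toFun q := ⟨fun y => q.1 * ‖(y : F)‖ ^ 2 + inner ℝ q.2.1 (y : F) + q.2.2, by fun_prop⟩
  map_add' q q' := by
    ext y
    simp only [Prod.fst_add, Prod.snd_add, inner_add_left, ContinuousMap.add_apply,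
      ContinuousMap.coe_mk]
    ring
  map_smul' t q := by
    ext y
    simp only [Prod.smul_fst, Prod.smul_snd, real_inner_smul_left, ContinuousMap.smul_apply,
      ContinuousMap.coe_mk, smul_eq_mul, RingHom.id_apply]
    ring

theorem sqDistSpan_le_range_quadraticMap (E : Set F) :
    sqDistSpan E ≤ LinearMap.range (quadraticMap E) := by
  refine Submodule.span_le.2 ?_
  rintro _ (rfl | ⟨c, rfl⟩)
  · exact ⟨(0, 0, 1), by ext y; simp [quadraticMap]⟩
  · refine ⟨(1, (-2 : ℝ) • c, ‖c‖ ^ 2), ?_⟩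
    ext y
    simp only [quadraticMap, sqDistMap, LinearMap.coe_mk, AddHom.coe_mk, ContinuousMap.coe_mk,
      dist_eq_norm, norm_sub_sq_real, real_inner_smul_left, real_inner_comm c]
    ring

theorem finiteDimensional_sqDistSpan [FiniteDimensional ℝ F] (E : Set F) :
    FiniteDimensional ℝ (sqDistSpan E) :=
  Submodule.finiteDimensional_of_le (sqDistSpan_le_range_quadraticMap E)

end SquaredDistances

section Spheres

variable {n m : ℕ} {f : Fin m → Eucl n ≃ᵈ Eucl n} {E : Set (Eucl n)}

/-- The self-map of the self-similar set `E` induced by `f i`. -/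
noncomputable def IsSelfSimilarSet.selfMap (hE : IsSelfSimilarSet f E) (i : Fin m) : C(E, E) :=
  ⟨(hE.mapsTo i).restrict, ((f i).toHomeomorph.continuous.restrict (hE.mapsTo i))⟩

theorem IsSelfSimilarSet.coe_foldr_selfMap (hE : IsSelfSimilarSet f E) (w : List (Fin m)) (y : E) :
    (w.foldr (fun i => hE.selfMap i) y : E).1 = wordMap f w y := by
  induction w with
  | nil => rfl
  | cons i w ih =>
    rw [List.foldr_cons, wordMap_cons, DilationEquiv.coe_mul, Function.comp_apply, ← ih]
    rfl

theorem IsSelfSimilarSet.exists_foldr_selfMap_mem (hE : IsSelfSimilarSet f E)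
    (hf : ∀ i, Dilation.ratio (f i) < 1) {U : Set E} (hU : IsOpen U) (hne : U.Nonempty) :
    ∃ w : List (Fin m), ∀ y, w.foldr (fun i => hE.selfMap i) y ∈ U := by
  obtain ⟨x, hx⟩ := hne
  obtain ⟨V, hV, rfl⟩ := isOpen_induced_iff.1 hU
  obtain ⟨w, hw⟩ := hE.exists_wordMap_image_subset hf x.2 (hV.mem_nhds hx)
  refine ⟨w, fun y => ?_⟩
  rw [Set.mem_preimage, hE.coe_foldr_selfMap]
  exact hw ⟨y, y.2, rfl⟩

theorem IsMarkovInvariant.measure_sphere_eq_zero {p : Fin m → ℝ≥0} {μ : Measure (Eucl n)}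
    [IsProbabilityMeasure μ] (hμ : IsMarkovInvariant (fun i => f i) p μ)
    (hE : IsSelfSimilarSet f E) (hf : ∀ i, Dilation.ratio (f i) < 1) (hp : ∀ i, 0 < p i)
    {c : Eucl n} {d : ℝ} (hd : 0 ≤ d) (hEd : ¬ E ⊆ sphere c d) : μ (sphere c d) = 0 := by
  have : CompactSpace E := isCompact_iff_compactSpace.1 hE.isCompact
  have : FiniteDimensional ℝ (sqDistSpan E) := finiteDimensional_sqDistSpan E
  have hval : MeasurableEmbedding (Subtype.val : E → Eucl n) :=
    MeasurableEmbedding.subtype_coe hE.isCompact.measurableSet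
  have hnull := hμ.measure_compl_selfSimilarSet hE hf
  have hν : IsMarkovInvariant (fun i => hE.selfMap i) p (μ.comap Subtype.val) :=
    hμ.comap (fun i => (dilation_measurableEmbedding (f i)).measurable)
      (fun i => (hE.selfMap i).continuous.measurable) hval (fun i y => rfl)
      (by rwa [Subtype.range_coe])
  let q : C(E, ℝ) := sqDistMap E c - d ^ 2 • (1 : C(E, ℝ))
  have hqQ : q ∈ sqDistSpan E := Submodule.sub_mem _ (sqDistMap_mem_sqDistSpan E c)
    (Submodule.smul_mem _ _ (one_mem_sqDistSpan E))
  have hq : ∀ y, q y = 0 ↔ (y : Eucl n) ∈ sphere c d := fun y => by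
    rw [mem_sphere, ← sq_eq_sq₀ dist_nonneg hd, ← sub_eq_zero (b := d ^ 2)]
    simp only [q, sqDistMap, ContinuousMap.sub_apply, ContinuousMap.coe_mk,
      ContinuousMap.smul_apply, ContinuousMap.one_apply, smul_eq_mul, mul_one]
  have hq0 : q ≠ 0 := fun h => hEd fun y hy => (hq ⟨y, hy⟩).1 (by rw [h]; rfl)
  have hzero := measure_zeroSet_eq_zero hν hp
    (fun i => map_sqDistSpan_comp_dilation (g := f i) fun y => rfl)
    (fun U hU hne => hE.exists_foldr_selfMap_mem hf hU hne) hqQ hq0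
  rw [hval.comap_apply] at hzero
  have hsub : sphere c d ∩ E ⊆ Subtype.val '' {y | q y = 0} :=
    fun y hy => ⟨⟨y, hy.2⟩, (hq _).2 hy.1, rfl⟩
  rw [← measure_inter_conull hnull]
  exact measure_mono_null hsub hzero

end Spheres

/-! ### Strong tangent measures -/

theorem strongTendsto_restrict_closedBall {n : ℕ} {μ : Measure (Eucl n)} [IsFiniteMeasure μ]
    {x : Eucl n} {d : ℝ} (hμx : μ (sphere x d) = 0) {z : ℕ → Eucl n}
    (hz : Tendsto z atTop (𝓝 x)) :
    StrongTendsto (fun j => μ.restrict (closedBall (z j) d)) (μ.restrict (closedBall x d)) := by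
  intro A hA
  simp only [Measure.restrict_apply hA]
  refine tendsto_measure_of_ae_tendsto_indicator_of_isFiniteMeasure atTop
    (hA.inter measurableSet_closedBall) (fun j => hA.inter measurableSet_closedBall) ?_
  filter_upwards [measure_eq_zero_iff_ae_notMem.1 hμx] with y hy
  have hlim : Tendsto (fun j => dist y (z j)) atTop (𝓝 (dist y x)) := tendsto_const_nhds.dist hz
  simp only [Set.mem_inter_iff, mem_closedBall]
  rcases lt_or_gt_of_ne (show dist y x ≠ d from hy) with hlt | hgt
  · filter_upwards [hlim.eventually_lt_const hlt] with j hj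
    simp only [hj.le, hlt.le]
  · filter_upwards [hlim.eventually_const_lt hgt] with j hj
    simp only [hj.not_ge, hgt.not_ge]

section DenseOrbits

variable {n m : ℕ} {f : Fin m → Eucl n ≃ᵈ Eucl n} {E : Set (Eucl n)}

theorem IsSelfSimilarSet.exists_wordMap_eq_of_mem_denseOrbitSet (hE : IsSelfSimilarSet f E)
    (hf : ∀ i, Dilation.ratio (f i) < 1) {x y : Eucl n} (hx : x ∈ E)
    (hy : y ∈ denseOrbitSet f E) {U : Set (Eucl n)} (hU : U ∈ 𝓝 x) (k : ℕ) :
    ∃ w : List (Fin m), k ≤ w.length ∧ ∃ z ∈ U, wordMap f w z = y := by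
  obtain ⟨u, rfl, -⟩ := hE.exists_wordMap_eq k hx
  obtain ⟨v, -, -, ⟨⟨z, hz, rfl⟩, -⟩, hv⟩ := mem_forwardOrbit.1
    (((hE.mem_denseOrbitSet_iff hf).1 hy).2 _ (mapsTo_wordMap hE.mapsTo u hx) (wordMap f u '' U)
      ((wordMap f u).toHomeomorph.isOpenMap.image_mem_nhds hU))
  refine ⟨v ++ u, List.length_append ▸ Nat.le_add_left _ _, z, hz, ?_⟩
  rw [wordMap_append, DilationEquiv.coe_mul, Function.comp_apply, hv]

theorem IsSelfSimilarSet.exists_tendsto_wordMap_eq (hE : IsSelfSimilarSet f E)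
    (hf : ∀ i, Dilation.ratio (f i) < 1) {x y : Eucl n} (hx : x ∈ E)
    (hy : y ∈ denseOrbitSet f E) :
    ∃ (w : ℕ → List (Fin m)) (z : ℕ → Eucl n), Tendsto z atTop (𝓝 x) ∧
      (∀ j, wordMap f (w j) (z j) = y) ∧ Tendsto (fun j => wordRatio f (w j)) atTop (𝓝 0) := by
  choose w hw z hz hwz using fun j : ℕ => hE.exists_wordMap_eq_of_mem_denseOrbitSet hf hx hy
    (ball_mem_nhds x (Nat.one_div_pos_of_nat (α := ℝ) (n := j))) j
  exact ⟨w, z, tendsto_iff_dist_tendsto_zero.2 (squeeze_zero (fun _ => dist_nonneg)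
    (fun j => (mem_ball.1 (hz j)).le) tendsto_one_div_add_atTop_nhds_zero_nat),
    hwz, tendsto_wordRatio_of_length hf hw⟩

end DenseOrbits

theorem smul_zoom {n : ℕ} {ν : Measure (Eucl n)} {x : Eucl n} {d : ℝ} {g : Eucl n ≃ᵈ Eucl n}
    (h0 : ν (closedBall x (d / Dilation.ratio g)) ≠ 0)
    (htop : ν (closedBall x (d / Dilation.ratio g)) ≠ ∞) :
    (ν (closedBall x (d / Dilation.ratio g))).toNNReal • zoom ν x d g =
      (ν.restrict (closedBall x (d / Dilation.ratio g))).map g := by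
  ext A -
  rw [zoom, Measure.smul_apply, Measure.smul_apply, smul_eq_mul, ENNReal.smul_def, smul_eq_mul,
    ENNReal.coe_toNNReal htop, ENNReal.mul_inv_cancel_left h0 htop]

namespace IsMarkovInvariant

variable {n m : ℕ} {f : Fin m → Eucl n ≃ᵈ Eucl n} {E O : Set (Eucl n)} {p : Fin m → ℝ≥0}
  {μ : Measure (Eucl n)} [IsProbabilityMeasure μ]

theorem map_symm_restrict_closedBall (hμ : IsMarkovInvariant (fun i => f i) p μ)
    (hE : IsSelfSimilarSet f E) (hf : ∀ i, Dilation.ratio (f i) < 1) (hO : IsFeasible f O)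
    (hp : ∀ i, 0 < p i) (w : List (Fin m)) {z : Eucl n} {d : ℝ} (hz : closedBall z d ⊆ O) :
    (wordProd p w)⁻¹ • (μ.restrict (closedBall (wordMap f w z) (d * wordRatio f w))).map
      (wordMap f w).symm = μ.restrict (closedBall z d) := by
  rw [wordRatio_eq_ratio, ← dilation_image_closedBall]
  exact (hμ.restrict_eq_map_symm hE hf hO hp w hz).symm

theorem exists_strongTendsto_restrict_closedBall (hμ : IsMarkovInvariant (fun i => f i) p μ)
    (hE : IsSelfSimilarSet f E) (hf : ∀ i, Dilation.ratio (f i) < 1) (hO : IsFeasible f O)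
    (hp : ∀ i, 0 < p i) {x : Eucl n} (hx : x ∈ E) {d : ℝ} (hd : 0 < d) (hxO : closedBall x d ⊆ O)
    {y : Eucl n} (hy : y ∈ denseOrbitSet f E) :
    ∃ w : ℕ → List (Fin m),
      Tendsto (fun j => wordRatio f (w j)) atTop (𝓝 0) ∧
      StrongTendsto
        (fun j => (wordProd p (w j))⁻¹ •
          (μ.restrict (closedBall y (d * wordRatio f (w j)))).map (wordMap f (w j)).symm)
        (μ.restrict (closedBall x d)) := by
  obtain ⟨w, z, hz, hwz, hw⟩ := hE.exists_tendsto_wordMap_eq hf hx hy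
  refine ⟨w, hw, fun A hA => ?_⟩
  have hsphere : μ (sphere x d) = 0 := hμ.measure_sphere_eq_zero hE hf hp hd.le fun h =>
    hd.ne ((dist_self x).symm.trans (h hx))
  refine (strongTendsto_restrict_closedBall hsphere hz A hA).congr' ?_
  filter_upwards [hz.eventually (eventually_closedBall_subset_of_isOpen hO.isOpen hd.le hxO)]
    with j hj
  rw [← hμ.map_symm_restrict_closedBall hE hf hO hp (w j) hj, hwz]

theorem measure_closedBall_ne_zero (hμ : IsMarkovInvariant (fun i => f i) p μ)
    (hE : IsSelfSimilarSet f E) (hf : ∀ i, Dilation.ratio (f i) < 1) (hp : ∀ i, 0 < p i)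
    {x : Eucl n} (hx : x ∈ E) {d : ℝ} (hd : 0 < d) : μ (closedBall x d) ≠ 0 :=
  ((Measure.mem_support_iff_forall x).1 (hμ.subset_support hE hf hp hx) _
    (closedBall_mem_nhds x hd)).ne'

theorem typicalClasses_subset (hμ : IsMarkovInvariant (fun i => f i) p μ)
    (hE : IsSelfSimilarSet f E) (hf : ∀ i, Dilation.ratio (f i) < 1) (hp : ∀ i, 0 < p i) (R : ℝ)
    {x : Eucl n} (hx : x ∈ denseOrbitSet f E) :
    typicalClasses R f E μ ⊆ strongTangentClasses R μ x := by
  rintro - ⟨α, rfl, z, d, ⟨hd, hz, O, hO, hzO⟩, hdR, hα⟩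
  obtain ⟨w, hw, hlim⟩ := hμ.exists_strongTendsto_restrict_closedBall hE hf hO hp hz hd hzO hx
  let g : ℕ → Eucl n ≃ᵈ Eucl n := fun j => (wordMap f (w j)).symm
  have hratio : ∀ j, Dilation.ratio (g j) = (wordRatio f (w j))⁻¹ := fun j => by
    rw [DilationEquiv.ratio_symm, wordRatio_eq_ratio]
  have hne : ∀ j, μ (closedBall x (d / Dilation.ratio (g j))) ≠ 0 := fun j =>
    hμ.measure_closedBall_ne_zero hE hf hp hx.1
      (div_pos hd (NNReal.coe_pos.2 (Dilation.ratio_pos (g j))))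
  refine ⟨hμ.subset_support hE hf hp hx.1, α, rfl, ?_, d, hd, hdR, fun j =>
    (wordProd p (w j))⁻¹ * (μ (closedBall x (d / Dilation.ratio (g j)))).toNNReal, g,
    fun j => ?_, ?_, ?_⟩
  · rw [hα, Ne, Measure.restrict_eq_zero]
    exact hμ.measure_closedBall_ne_zero hE hf hp hz hd
  · exact mul_pos (inv_pos.2 (wordProd_pos hp _))
      (ENNReal.toNNReal_pos (hne j) (measure_ne_top _ _))
  · simp only [hratio]
    exact tendsto_inv_nhdsGT_zero.comp (tendsto_nhdsWithin_iff.2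
      ⟨hw, Eventually.of_forall fun j => wordRatio_pos f (w j)⟩)
  · simp only [mul_smul, smul_zoom (hne _) (measure_ne_top μ _)]
    simpa only [hα, hratio, NNReal.coe_inv, div_inv_eq_mul] using hlim

end IsMarkovInvariant

theorem theorem3p5_general {n m : ℕ} (f : Fin m → Eucl n ≃ᵈ Eucl n)
    (hf : ∀ i, Dilation.ratio (f i) < 1)
    (E : Set (Eucl n)) (hE : IsSelfSimilarSet f E)
    (O : Set (Eucl n)) (hO : IsFeasible f O)
    (p : Fin m → ℝ≥0) (hp : ∀ i, 0 < p i)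
    (μ : Measure (Eucl n)) [IsProbabilityMeasure μ] (hμ : IsMarkovInvariant (fun i => f i) p μ) :
    (∀ B : Set (Eucl n), B ⊆ O → ∀ w : List (Fin m),
      μ.restrict (wordMap f w '' B) = wordProd p w • (μ.restrict B).map (wordMap f w)) ∧
    (∀ B : Set (Eucl n), B ⊆ O → ∀ w : List (Fin m),
      μ.restrict B =
        (wordProd p w)⁻¹ • (μ.restrict (wordMap f w '' B)).map (wordMap f w).symm) ∧
    (denseOrbitSet f E ⊆ E ∧ μ (denseOrbitSet f E) = 1 ∧ μ (denseOrbitSet f E)ᶜ = 0 ∧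
      ∀ x ∈ E, ∀ d : ℝ, 0 < d → closedBall x d ⊆ O → ∀ y ∈ denseOrbitSet f E,
        ∃ w : ℕ → List (Fin m),
          Tendsto (fun j => wordRatio f (w j)) atTop (𝓝 0) ∧
          StrongTendsto
            (fun j => (wordProd p (w j))⁻¹ •
              (μ.restrict (closedBall y (d * wordRatio f (w j)))).map (wordMap f (w j)).symm)
            (μ.restrict (closedBall x d))) ∧
    (∀ R : ℝ, ∀ x ∈ denseOrbitSet f E,
      typicalClasses R f E μ ⊆ strongTangentClasses R μ x) := by
  have hnull := hμ.measure_compl_denseOrbitSet hE hf hp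
  have hfull : μ (denseOrbitSet f E) = 1 :=
    (measure_of_measure_compl_eq_zero hnull).trans measure_univ
  exact ⟨fun _ hB w => hμ.restrict_wordMap_image hE hf hO w hB,
    fun _ hB w => hμ.restrict_eq_map_symm hE hf hO hp w hB,
    ⟨fun _ hy => hy.1, hfull, hnull, fun _ hx _ hd hxO _ hy =>
      hμ.exists_strongTendsto_restrict_closedBall hE hf hO hp hx hd hxO hy⟩,
    fun R _ hx => hμ.typicalClasses_subset hE hf hp R hx⟩

theorem theorem3p5 {n m : ℕ} (f : Fin m → Eucl n ≃ᵈ Eucl n)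
    (hf : ∀ i, Dilation.ratio (f i) < 1)
    (E : Set (Eucl n)) (hE : IsSelfSimilarSet f E)
    (O : Set (Eucl n)) (hO : IsFeasible f O)
    (p : Fin m → ℝ≥0) (hp : ∀ i, 0 < p i) (hsum : ∑ i, p i = 1)
    (μ : Measure (Eucl n)) (hμ : IsSelfSimilarMeasure f p μ) :
    (∀ B : Set (Eucl n), B ⊆ O → NullMeasurableSet B μ → ∀ w : List (Fin m),
      μ.restrict (wordMap f w '' B) = wordProd p w • (μ.restrict B).map (wordMap f w)) ∧
    (∀ B : Set (Eucl n), B ⊆ O → NullMeasurableSet B μ → ∀ w : List (Fin m),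
      μ.restrict B =
        (wordProd p w)⁻¹ • (μ.restrict (wordMap f w '' B)).map (wordMap f w).symm) ∧
    (denseOrbitSet f E ⊆ E ∧ μ (denseOrbitSet f E) = 1 ∧ μ (denseOrbitSet f E)ᶜ = 0 ∧
      ∀ x ∈ E, ∀ d : ℝ, 0 < d → closedBall x d ⊆ O → ∀ y ∈ denseOrbitSet f E,
        ∃ w : ℕ → List (Fin m),
          Tendsto (fun j => wordRatio f (w j)) atTop (𝓝 0) ∧
          StrongTendsto
            (fun j => (wordProd p (w j))⁻¹ •
              (μ.restrict (closedBall y (d * wordRatio f (w j)))).map (wordMap f (w j)).symm)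
            (μ.restrict (closedBall x d))) ∧
    (∀ R : ℝ, 0 < R → ∀ x ∈ denseOrbitSet f E,
      typicalClasses R f E μ ⊆ strongTangentClasses R μ x) := by
  have := hμ.isProbabilityMeasure
  have ⟨himage, hpreimage, hdense, htangent⟩ := theorem3p5_general f hf E hE O hO p hp μ hμ.fixed
  exact ⟨fun B hB _ => himage B hB, fun B hB _ => hpreimage B hB, hdense, fun R _ => htangent R⟩
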